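/- Let $F$ be a field of characteristic $p$ (with $p=0$ allowed), let $n\ge 1$, and let $U_1,\dots,U_n$ be finite sets with $|U_i|\ge 2$. Put $X=U_1\times\cdots\times U_n$ and $d=2^n-1$. For $g\in[0,d]=\{0,1,\dots,d\}$ with binary expansion $g=\sum_{h=1}^n g_{(h)}2^{h-1}$, let $$R_g=\{(\mathbf a,\mathbf b)\in X\times X:\ \text{for all } h,\ \mathbf a_h\ne\mathbf b_h \text{ if and only if } g_{(h)}=1\}.$$ Then $\{R_0,\dots,R_d\}$ is a (symmetric) association scheme on $X$, called a factorial scheme. Let $k_g$ be the valency of $R_g$, i.e. the number of $\mathbf b\in X$ with $(\mathbf a,\mathbf b)\in R_g$, for any $\mathbf a\in X$. Let $A_g$ be the adjacency matrix of $R_g$ over $F$. Fix $\mathbf x\in X$, and let $E_g^*$ be the diagonal $\{0,1\}$-matrix over $F$, with rows and columns indexed by $X$, whose $(\mathbf y,\mathbf y)$-entry is $1$ if and only if $(\mathbf x,\mathbf y)\in R_g$. Let $\mathbb T$ be the Terwilliger $F$-algebra of the scheme with respect to $\mathbf x$, i.e. the subalgebra of the full matrix algebra $\mathrm M_X(F)$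 generated by $E_0^*,\dots,E_d^*,A_0,\dots,A_d$. **Theorem.** $\mathbb T$ is semisimple if and only if $p\nmid k_g$ for every $g\in[0,d]$. Moreover, $\mathbb T$ is semisimple if and only if for every $g\in[0,d]$ the corner algebra $E_g^*\mathbb T E_g^*$ (with identity element $E_g^*$) is semisimple. -/

import Mathlib

/-- A `d`-class association scheme on `X`, with relations `R_0, …, R_d` (`rel g x y` means
`(x, y) ∈ R_g`): the `R_g` are nonempty and partition `X × X`, `R_0` is the diagonal, the transpose
of every relation is again one of the relations, and for all `g h i` there is a number `m` such that
every `(x, y) ∈ R_i` admits exactly `m` elements `a` with `(x, a) ∈ R_g` and `(a, y) ∈ R_h`. -/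
structure AssociationScheme (X : Type*) (d : ℕ) where
  rel : Fin (d + 1) → X → X → Prop
  rel_nonempty : ∀ g, ∃ x y, rel g x y
  existsUnique_rel : ∀ x y, ∃! g, rel g x y
  rel_zero : ∀ x y, rel 0 x y ↔ x = y
  exists_transpose : ∀ g, ∃ g', ∀ x y, rel g' x y ↔ rel g y x
  exists_intersection : ∀ g h i, ∃ m : ℕ, ∀ x y, rel i x y →
    Nat.card {a : X // rel g x a ∧ rel h a y} = m

namespace AssociationScheme

variable {X : Type*} {d : ℕ} (S : AssociationScheme X d)

/-- The index `g'` of the transposed relation of `R_g`. -/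
noncomputable def transpose (g : Fin (d + 1)) : Fin (d + 1) :=
  (S.exists_transpose g).choose

/-- The intersection number `p_{gh}^i`. It is determined by `S`, since `R_i` is nonempty. -/
noncomputable def intersectionNumber (g h i : Fin (d + 1)) : ℕ :=
  (S.exists_intersection g h i).choose

/-- The valency `k_g = p_{gg'}^0` of `R_g`. -/
noncomputable def valency (g : Fin (d + 1)) : ℕ :=
  S.intersectionNumber g (S.transpose g) 0

theorem rel_transpose (g : Fin (d + 1)) (x y : X) :
    S.rel (S.transpose g) x y ↔ S.rel g y x :=
  (S.exists_transpose g).choose_spec x y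

theorem card_eq_intersectionNumber (g h i : Fin (d + 1)) (x y : X) (hxy : S.rel i x y) :
    Nat.card {a : X // S.rel g x a ∧ S.rel h a y} = S.intersectionNumber g h i :=
  (S.exists_intersection g h i).choose_spec x y hxy

theorem valency_eq_card (g : Fin (d + 1)) (x : X) :
    S.valency g = Nat.card {a : X // S.rel g x a} := by
  rw [valency, ← S.card_eq_intersectionNumber g (S.transpose g) 0 x x ((S.rel_zero x x).2 rfl)]
  simp only [rel_transpose, and_self]

section Terwilliger

variable (F : Type*) [Field F]

open Classical in
/-- The adjacency matrix `A_g` over `F` of the relation `R_g`. -/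
noncomputable def adjMatrix (g : Fin (d + 1)) : Matrix X X F :=
  Matrix.of fun y z => if S.rel g y z then 1 else 0

variable [DecidableEq X]

open Classical in
/-- The dual idempotent `E_g^*(x)` over `F`: the diagonal `0-1` matrix whose `(y, y)` entry is `1`
if and only if `(x, y) ∈ R_g`. -/
noncomputable def dualIdempotent (x : X) (g : Fin (d + 1)) : Matrix X X F :=
  Matrix.diagonal fun y => if S.rel g x y then 1 else 0

variable [Fintype X]

/-- The Terwilliger `F`-algebra `T(x)`: the subalgebra of the full matrix algebra generated by
all dual idempotents `E_g^*(x)` and all adjacency matrices `A_g`. -/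
noncomputable def terwilliger (x : X) : Subalgebra F (Matrix X X F) :=
  Algebra.adjoin F (Set.range (S.dualIdempotent F x) ∪ Set.range (S.adjMatrix F))

/-- `E_g^*(x)` as an element of the Terwilliger algebra `T(x)`. -/
noncomputable def terwilligerIdempotent (x : X) (g : Fin (d + 1)) : S.terwilliger F x :=
  ⟨S.dualIdempotent F x g, Algebra.subset_adjoin (Or.inl ⟨g, rfl⟩)⟩

theorem isIdempotentElem_terwilligerIdempotent (x : X) (g : Fin (d + 1)) :
    IsIdempotentElem (S.terwilligerIdempotent F x g) := by
  apply Subtype.ext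
  simp [terwilligerIdempotent, dualIdempotent, Matrix.diagonal_mul_diagonal]

/-- The corner algebra `E_g^*(x) T(x) E_g^*(x) = {E_g^*(x) M E_g^*(x) : M ∈ T(x)}`, a ring with
identity element `E_g^*(x)`. -/
abbrev TerwilligerCorner (x : X) (g : Fin (d + 1)) : Type _ :=
  (S.isIdempotentElem_terwilligerIdempotent F x g).Corner

end Terwilliger

end AssociationScheme

section Factorial

variable {n : ℕ} (U : Fin n → Type*)

/-- The relation `a =_j b` on the cartesian product of the `U k`: the tuples `a` and `b` differ
exactly in the coordinates `k` at which the binary expansion of `j` has digit `1`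
(coordinates are numbered from `0`, coordinate `k` corresponding to the digit of `2 ^ k`). -/
def factorialRel (j : ℕ) (a b : ∀ k, U k) : Prop :=
  ∀ k : Fin n, a k ≠ b k ↔ j.testBit k = true

theorem exists_factorialIndex (P : Fin n → Prop) :
    ∃ j : Fin (2 ^ n - 1 + 1), ∀ k : Fin n, P k ↔ (j : ℕ).testBit k = true := by
  classical
  have h : Nat.ofBits (fun k => decide (P k)) < 2 ^ n := Nat.ofBits_lt_two_pow _
  refine ⟨⟨Nat.ofBits (fun k => decide (P k)), by omega⟩, fun k => ?_⟩
  simp [Nat.testBit_ofBits_lt _ _ k.isLt]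

theorem factorialIndex_ext {i j : Fin (2 ^ n - 1 + 1)}
    (h : ∀ k : Fin n, (i : ℕ).testBit k = true ↔ (j : ℕ).testBit k = true) : i = j := by
  have hn : 0 < 2 ^ n := by positivity
  apply Fin.ext
  apply Nat.eq_of_testBit_eq
  intro m
  by_cases hm : m < n
  · exact Bool.eq_iff_iff.2 (h ⟨m, hm⟩)
  · have hle : 2 ^ n ≤ 2 ^ m := Nat.pow_le_pow_right (by norm_num) (by omega)
    rw [Nat.testBit_lt_two_pow (by have := i.isLt; omega),
      Nat.testBit_lt_two_pow (by have := j.isLt; omega)]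

/-- The factorial scheme on the cartesian product of sets `U k` with at least two elements: its
relations are the `R_j = {(a, b) : a =_j b}` for `0 ≤ j ≤ 2 ^ n - 1`. -/
def factorialScheme [∀ k, Nontrivial (U k)] : AssociationScheme (∀ k, U k) (2 ^ n - 1) where
  rel j := factorialRel U j
  rel_nonempty j := by
    classical
    choose a b hab using fun k => exists_pair_ne (U k)
    refine ⟨a, fun k => if (j : ℕ).testBit k = true then b k else a k, fun k => ?_⟩
    by_cases h : (j : ℕ).testBit k = true <;> simp [h, hab k]
  existsUnique_rel a b := by
    obtain ⟨j, hj⟩ := exists_factorialIndex fun k => a k ≠ b k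
    exact ⟨j, hj, fun i hi => factorialIndex_ext fun k => (hi k).symm.trans (hj k)⟩
  rel_zero a b := by simp [factorialRel, funext_iff]
  exists_transpose j := ⟨j, fun a b => by simp only [factorialRel, ne_comm]⟩
  exists_intersection g h i := by
    classical
    by_cases H : ∃ x y : ∀ k, U k, factorialRel U i x y
    · obtain ⟨x, y, hxy⟩ := H
      refine ⟨Nat.card {a // factorialRel U g x a ∧ factorialRel U h a y}, fun x' y' hxy' => ?_⟩
      have key : ∀ k, ∃ e : U k ≃ U k, e (x' k) = x k ∧ e (y' k) = y k := by
        intro k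
        have hk : x' k = y' k ↔ x k = y k := not_iff_not.1 ((hxy' k).trans (hxy k).symm)
        by_cases hxk : x k = y k
        · exact ⟨Equiv.swap (x' k) (x k), by simp, by rw [← hk.2 hxk, ← hxk]; simp⟩
        · have hxk' : x' k ≠ y' k := fun e => hxk (hk.1 e)
          let s := Equiv.swap (x' k) (x k)
          have hs : s (y' k) ≠ x k := fun e => hxk' (s.injective (by simp [s, e]))
          refine ⟨s.trans (Equiv.swap (s (y' k)) (y k)), ?_, by simp⟩
          simp only [Equiv.trans_apply, s, Equiv.swap_apply_left]
          exact Equiv.swap_apply_of_ne_of_ne hs.symm hxk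
      choose e hex hey using key
      refine Nat.card_congr ((Equiv.piCongrRight e).subtypeEquiv fun a => ?_)
      simp only [factorialRel, Equiv.piCongrRight_apply, Pi.map_apply, ← hex, ← hey, ne_eq,
        EmbeddingLike.apply_eq_iff_eq]
    · exact ⟨0, fun x y hxy => absurd ⟨x, y, hxy⟩ H⟩

end Factorial

/-!
For an artinian ring, semisimplicity is equivalent to semiprimeness (`a R a = 0` only for `a = 0`),
and both properties pass to corners `e R e`. So it suffices to show that semisimple corners force
all valencies `k_g` to be nonzero in `F`, and that nonzero valencies make `T` semiprime.

*Necessity* holds for every association scheme. The algebra `T` maps the span of the characteristic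
vectors of the subconstituents `x R_g` into itself (`AssociationScheme.mulVec_mem_primary`), so the
entries of `M ∈ T` on the block `x R_g × x R_g` have constant row sums and their total is a multiple
of `k_g`. Hence if `k_g = 0` in `F`, the nonzero matrix `J_g = E_g^* J E_g^*`, with `J` the all-one
matrix, satisfies `J_g T J_g = 0` (`AssociationScheme.vecMulVec_mul_mul_eq_zero`), and
`E_g^* T E_g^*` is not semiprime.

*Sufficiency* uses that `T` is the tensor product over the coordinates `h` of the algebras spanned
by `ssᵀ, srᵀ, rsᵀ, rrᵀ, diag(r)`, where `s` and `r` are the characteristic vectors of `{x_h}` and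
of its complement in `U_h` (`terwilliger_factorialScheme`). The number `|U_h| - 1` is the valency of
the relation "differ exactly at `h`". If it is invertible, then such a factor is the product of a
`2 × 2` matrix algebra and a copy of `F` (or `0`), with `1` the sum of the idempotents `ssᵀ`,
`(|U_h| - 1)⁻¹ rrᵀ` and `diag(r) - (|U_h| - 1)⁻¹ rrᵀ`. Every block `ε b ε'` between two of them
is a multiple of a fixed `m` with `m m' m = m` for some `m'` (`exists_span_block`). This property is
inherited by tensor products and makes them semiprime (`isSemiprimeRing_tensorSubalgebra`).
-/

/-! ### Semiprime rings, semisimplicity and corners -/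

/-- A (not necessarily commutative) ring is *semiprime* if `a R a = 0` only holds for `a = 0`. -/
def IsSemiprimeRing (R : Type*) [Ring R] : Prop :=
  ∀ a : R, (∀ t, a * t * a = 0) → a = 0

/-- The left ideal `R a` is generated by an idempotent `e = t a`, and `a = a e = a t a`. -/
theorem IsSemisimpleRing.isSemiprimeRing (R : Type*) [Ring R] [IsSemisimpleRing R] :
    IsSemiprimeRing R := by
  intro a ha
  obtain ⟨e, he, hspan⟩ := IsSemisimpleRing.ideal_eq_span_idempotent (Ideal.span {a})
  obtain ⟨t, ht⟩ := Ideal.mem_span_singleton'.1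
    (hspan ▸ Ideal.mem_span_singleton_self e : e ∈ Ideal.span {a})
  obtain ⟨s, hs⟩ := Ideal.mem_span_singleton'.1
    (hspan ▸ Ideal.mem_span_singleton_self a : a ∈ Ideal.span {e})
  calc a = s * e := hs.symm
    _ = s * e * e := by rw [mul_assoc, he.eq]
    _ = a * t * a := by rw [hs, mul_assoc, ht]
    _ = 0 := ha t

theorem IsSemiprimeRing.isSemisimpleRing {R : Type*} [Ring R] [IsArtinianRing R]
    (h : IsSemiprimeRing R) : IsSemisimpleRing R := by
  rw [IsArtinianRing.isSemisimpleRing_iff_jacobson]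
  have key : ∀ n, Ring.jacobson R ^ (n + 1) = ⊥ → Ring.jacobson R = ⊥ := by
    intro n
    induction n with
    | zero => exact fun h₁ => (Submodule.pow_one _).symm.trans h₁
    | succ n ih =>
      refine fun hn => ih (eq_bot_iff.2 fun a ha => h a fun t => ?_)
      have hmem : a * (t * a) ∈ Ring.jacobson R ^ (n + 1 + 1) := by
        rw [Submodule.pow_succ' _ n.succ_ne_zero]
        refine Ideal.mul_mem_mul ?_ (Ideal.mul_mem_left _ t ha)
        exact Ideal.mul_le_right (I := Ring.jacobson R ^ n) (J := Ring.jacobson R) ha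
      rw [hn, ← mul_assoc] at hmem
      exact (Submodule.mem_bot R).1 hmem
  obtain ⟨n, hn⟩ := IsSemiprimaryRing.isNilpotent (R := R)
  exact key n (by rw [Submodule.pow_succ, hn, Submodule.zero_eq_bot, Submodule.bot_mul])

section Corner

variable {R : Type*} [Ring R] {e : R} (he : IsIdempotentElem e)

include he in
theorem mul_mul_self_of_mem_corner {a : R} (ha : a ∈ Subsemigroup.corner e) : e * a * e = a := by
  obtain ⟨h₁, h₂⟩ := (Subsemigroup.mem_corner_iff he).1 ha
  rw [h₁, h₂]

theorem IsSemiprimeRing.corner (h : IsSemiprimeRing R) : IsSemiprimeRing he.Corner := by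
  intro a ha
  obtain ⟨h₁, h₂⟩ := (Subsemigroup.mem_corner_iff he).1 a.2
  refine Subtype.ext (h a.1 fun t => ?_)
  have := congrArg Subtype.val (ha ⟨e * t * e, t, rfl⟩)
  change a.1 * (e * t * e) * a.1 = 0 at this
  calc a.1 * t * a.1 = (a.1 * e) * t * (e * a.1) := by rw [h₁, h₂]
    _ = a.1 * (e * t * e) * a.1 := by noncomm_ring
    _ = 0 := this

/-- The left ideals `I` of `e R e` embed into those of `R` by `I ↦ R I`, as `I = e (R I) e`. -/
theorem isArtinianRing_corner [IsArtinianRing R] : IsArtinianRing he.Corner := by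
  let φ : Ideal he.Corner → Ideal R := fun I => Ideal.span (Subtype.val '' (I : Set he.Corner))
  have mem_of_eq : ∀ (I : Ideal he.Corner) (a b : he.Corner), b ∈ I → a.1 = b.1 → a ∈ I :=
    fun I a b hb hab => (Subtype.ext hab : a = b) ▸ hb
  have hmem : ∀ (I : Ideal he.Corner) (y : R), y ∈ φ I →
      ∀ r : R, (⟨e * (r * y) * e, _, rfl⟩ : he.Corner) ∈ I := by
    intro I y hy
    induction hy using Submodule.span_induction with
    | mem y hy =>
      rintro r
      obtain ⟨z, hz, rfl⟩ := hy
      obtain ⟨h₁, h₂⟩ := (Subsemigroup.mem_corner_iff he).1 z.2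
      refine mem_of_eq _ _ _ (I.mul_mem_left (⟨e * r * e, r, rfl⟩ : he.Corner) hz) ?_
      change e * (r * z.1) * e = e * r * e * z.1
      rw [mul_assoc (e * r), h₁, mul_assoc, mul_assoc, h₂, mul_assoc]
    | zero =>
      intro r
      refine mem_of_eq _ _ _ I.zero_mem ?_
      change e * (r * 0) * e = 0
      simp
    | add y z _ _ hy hz =>
      intro r
      refine mem_of_eq _ _ _ (I.add_mem (hy r) (hz r)) ?_
      change e * (r * (y + z)) * e = e * (r * y) * e + e * (r * z) * e
      noncomm_ring
    | smul a y _ hy =>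
      intro r
      refine mem_of_eq _ _ _ (hy (r * a)) ?_
      change e * (r * (a * y)) * e = e * (r * a * y) * e
      rw [mul_assoc r]
  have hle : ∀ I J, φ I ≤ φ J → I ≤ J := by
    intro I J hIJ z hz
    refine mem_of_eq _ _ _ (hmem J z.1 (hIJ (Ideal.subset_span ⟨z, hz, rfl⟩)) 1) ?_
    change z.1 = e * (1 * z.1) * e
    rw [one_mul, mul_mul_self_of_mem_corner he z.2]
  have hmono : StrictMono φ := fun I J hIJ =>
    lt_of_le_not_ge (Ideal.span_mono (Set.image_mono hIJ.le)) fun h => hIJ.not_ge (hle _ _ h)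
  exact hmono.wellFoundedLT

end Corner

/-! ### The primary module obstructs semisimplicity -/

namespace AssociationScheme

variable {X : Type*} {d : ℕ} (S : AssociationScheme X d) (F : Type*) [Field F]

open Classical in
/-- The characteristic vector over `F` of the subconstituent `x R_g = {y : (x, y) ∈ R_g}`. -/
noncomputable def subconstituent (x : X) (g : Fin (d + 1)) : X → F :=
  fun y => if S.rel g x y then 1 else 0

theorem vecMulVec_subconstituent_ne_zero (x : X) (g : Fin (d + 1)) (hx : ∃ y, S.rel g x y) :
    Matrix.vecMulVec (S.subconstituent F x g) (S.subconstituent F x g) ≠ 0 := by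
  obtain ⟨y, hy⟩ := hx
  intro h
  simpa [Matrix.vecMulVec_apply, subconstituent, hy] using congrFun (congrFun h y) y

theorem sum_subconstituent [Fintype X] (x : X) (g : Fin (d + 1)) :
    ∑ y, S.subconstituent F x g y = S.valency g := by
  classical
  rw [S.valency_eq_card g x, Nat.card_eq_fintype_card, Fintype.card_subtype]
  simp [subconstituent, Finset.sum_boole]

theorem adjMatrix_mulVec_subconstituent [Fintype X] (x : X) (g h : Fin (d + 1)) :
    (S.adjMatrix F g).mulVec (S.subconstituent F x h) =
      ∑ i, (S.intersectionNumber h (S.transpose g) i : F) • S.subconstituent F x i := by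
  classical
  ext y
  obtain ⟨i, hi, huniq⟩ := S.existsUnique_rel x y
  rw [Finset.sum_apply, Finset.sum_eq_single i]
  · rw [← S.card_eq_intersectionNumber h (S.transpose g) i x y hi, Nat.card_eq_fintype_card,
      Fintype.card_subtype]
    simp only [Matrix.mulVec, dotProduct, adjMatrix, subconstituent, Matrix.of_apply,
      Pi.smul_apply, hi, if_true, smul_eq_mul, mul_one, ← ite_and, mul_ite, mul_zero,
      Finset.sum_boole, rel_transpose]
  · intro j _ hj
    simp [subconstituent, show ¬S.rel j x y from fun h' => hj (huniq j h')]
  · simp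

variable [DecidableEq X] [Fintype X]

theorem dualIdempotent_mulVec_subconstituent (x : X) (g h : Fin (d + 1)) :
    (S.dualIdempotent F x g).mulVec (S.subconstituent F x h) =
      (if g = h then (1 : F) else 0) • S.subconstituent F x g := by
  classical
  ext y
  rw [dualIdempotent, Matrix.mulVec_diagonal]
  obtain ⟨i, hi, huniq⟩ := S.existsUnique_rel x y
  by_cases hg : S.rel g x y <;> by_cases hh : S.rel h x y
  · simp [subconstituent, hh, (huniq g hg).trans (huniq h hh).symm]
  · simp [subconstituent, hg, hh, show g ≠ h from fun e => hh (e ▸ hg)]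
  · simp [subconstituent, hg]
  · simp [subconstituent, hg]

/-- The span of the characteristic vectors of the subconstituents (the primary module) is a
submodule of the standard module of the Terwilliger algebra. -/
theorem mulVec_mem_primary (x : X) {M : Matrix X X F} (hM : M ∈ S.terwilliger F x) {v : X → F}
    (hv : v ∈ Submodule.span F (Set.range (S.subconstituent F x))) :
    M.mulVec v ∈ Submodule.span F (Set.range (S.subconstituent F x)) := by
  classical
  induction hM using Algebra.adjoin_induction generalizing v with
  | mem M hM =>
    induction hv using Submodule.span_induction with
    | mem v hv =>
      obtain ⟨h, rfl⟩ := hv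
      obtain ⟨g, rfl⟩ | ⟨g, rfl⟩ := hM
      · rw [dualIdempotent_mulVec_subconstituent]
        exact Submodule.smul_mem _ _ (Submodule.subset_span ⟨g, rfl⟩)
      · rw [adjMatrix_mulVec_subconstituent]
        exact Submodule.sum_mem _ fun i _ =>
          Submodule.smul_mem _ _ (Submodule.subset_span ⟨i, rfl⟩)
    | zero => simp
    | add v w _ _ hv hw => rw [Matrix.mulVec_add]; exact Submodule.add_mem _ hv hw
    | smul c v _ hv => rw [Matrix.mulVec_smul]; exact Submodule.smul_mem _ _ hv
  | algebraMap c =>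
    rw [Algebra.algebraMap_eq_smul_one, Matrix.smul_mulVec, Matrix.one_mulVec]
    exact Submodule.smul_mem _ _ hv
  | add M N _ _ hM hN => rw [Matrix.add_mulVec]; exact Submodule.add_mem _ (hM hv) (hN hv)
  | mul M N _ _ hM hN => rw [← Matrix.mulVec_mulVec]; exact hM (hN hv)

/-- On a subconstituent, vectors of the primary module are constant, so their coordinate sum over
`x R_g` is a multiple of the valency `k_g`. -/
theorem subconstituent_dotProduct_eq_zero (x : X) {g : Fin (d + 1)}
    (hg : (S.valency g : F) = 0) {v : X → F}
    (hv : v ∈ Submodule.span F (Set.range (S.subconstituent F x))) :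
    S.subconstituent F x g ⬝ᵥ v = 0 := by
  classical
  induction hv using Submodule.span_induction with
  | mem v hv =>
    obtain ⟨h, rfl⟩ := hv
    have hE := congrArg (fun w => ∑ y, w y) (S.dualIdempotent_mulVec_subconstituent F x g h)
    simp only [dualIdempotent, Matrix.mulVec_diagonal, Pi.smul_apply, ← Finset.smul_sum,
      sum_subconstituent, hg, smul_zero] at hE
    exact hE
  | zero => simp
  | add v w _ _ hv hw => rw [dotProduct_add, hv, hw, add_zero]
  | smul c v _ hv => rw [dotProduct_smul, hv, smul_zero]

/-- The block `E_g^* J E_g^*` of the all-one matrix `J = A_0 + ⋯ + A_d`. -/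
theorem vecMulVec_subconstituent_mem (x : X) (g : Fin (d + 1)) :
    Matrix.vecMulVec (S.subconstituent F x g) (S.subconstituent F x g) ∈ S.terwilliger F x := by
  classical
  have hE : S.dualIdempotent F x g ∈ S.terwilliger F x :=
    Algebra.subset_adjoin (Or.inl ⟨g, rfl⟩)
  have hJ : ∑ i, S.adjMatrix F i ∈ S.terwilliger F x :=
    Subalgebra.sum_mem _ fun i _ => Algebra.subset_adjoin (Or.inr ⟨i, rfl⟩)
  convert mul_mem (mul_mem hE hJ) hE using 1
  ext y z
  obtain ⟨i, hi, huniq⟩ := S.existsUnique_rel y z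
  have h1 : (∑ i, S.adjMatrix F i) y z = 1 := by
    rw [Matrix.sum_apply, Finset.sum_eq_single i]
    · simp [adjMatrix, hi]
    · intro j _ hj
      simp [adjMatrix, show ¬S.rel j y z from fun h' => hj (huniq j h')]
    · simp
  rw [dualIdempotent, Matrix.mul_diagonal, Matrix.diagonal_mul, h1, mul_one]
  rfl

theorem dualIdempotent_mul_vecMulVec (x : X) (g : Fin (d + 1)) (w : X → F) :
    S.dualIdempotent F x g * Matrix.vecMulVec (S.subconstituent F x g) w =
      Matrix.vecMulVec (S.subconstituent F x g) w := by
  rw [Matrix.mul_vecMulVec, dualIdempotent_mulVec_subconstituent, if_pos rfl, one_smul]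

theorem vecMulVec_mul_dualIdempotent (x : X) (g : Fin (d + 1)) (w : X → F) :
    Matrix.vecMulVec w (S.subconstituent F x g) * S.dualIdempotent F x g =
      Matrix.vecMulVec w (S.subconstituent F x g) := by
  have := congrArg Matrix.transpose (S.dualIdempotent_mul_vecMulVec F x g w)
  rwa [Matrix.transpose_mul, Matrix.transpose_vecMulVec, dualIdempotent,
    Matrix.diagonal_transpose] at this

/-- If `k_g = 0` in `F`, then `J_g = E_g^* J E_g^*` satisfies `J_g T J_g = 0`: for `M ∈ T`, the
matrix `J_g M J_g` is `J_g` scaled by the sum of the entries of `M` on `x R_g × x R_g`. -/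
theorem vecMulVec_mul_mul_eq_zero (x : X) {g : Fin (d + 1)} (hg : (S.valency g : F) = 0)
    {M : Matrix X X F} (hM : M ∈ S.terwilliger F x) :
    Matrix.vecMulVec (S.subconstituent F x g) (S.subconstituent F x g) * M *
      Matrix.vecMulVec (S.subconstituent F x g) (S.subconstituent F x g) = 0 := by
  rw [mul_assoc, Matrix.mul_vecMulVec, Matrix.vecMulVec_mul_vecMulVec,
    S.subconstituent_dotProduct_eq_zero F x hg
      (S.mulVec_mem_primary F x hM (Submodule.subset_span ⟨g, rfl⟩)), zero_smul,
      Matrix.vecMulVec_zero]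

theorem valency_ne_zero_of_isSemiprimeRing_corner (x : X) (g : Fin (d + 1))
    (hx : ∃ y, S.rel g x y) (h : IsSemiprimeRing (S.TerwilligerCorner F x g)) :
    (S.valency g : F) ≠ 0 := fun hg => by
  have hmem : (⟨_, S.vecMulVec_subconstituent_mem F x g⟩ : S.terwilliger F x) ∈
      Subsemigroup.corner (S.terwilligerIdempotent F x g) :=
    (Subsemigroup.mem_corner_iff (S.isIdempotentElem_terwilligerIdempotent F x g)).2
      ⟨Subtype.ext (S.dualIdempotent_mul_vecMulVec F x g _),
        Subtype.ext (S.vecMulVec_mul_dualIdempotent F x g _)⟩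
  have h0 := h ⟨_, hmem⟩ fun M =>
    Subtype.ext (Subtype.ext (S.vecMulVec_mul_mul_eq_zero F x hg M.1.2))
  exact S.vecMulVec_subconstituent_ne_zero F x g hx
    (congrArg Subtype.val (congrArg Subtype.val h0))

end AssociationScheme

/-! ### The Terwilliger algebra of a single coordinate -/

section LocalAlgebra

variable {Y : Type*} [DecidableEq Y] (F : Type*) [Field F] (o : Y)

open Matrix

/-- The characteristic vector of the complement of `{o}`. -/
def coVec : Y → F := fun y => if y = o then 0 else 1

local notation "s" => (Pi.single o 1 : Y → F)
local notation "r" => coVec F o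

/-- The matrix `α ssᵀ + β srᵀ + γ rsᵀ + δ rrᵀ + ε diag(r)`, where `s` and `r` are the
characteristic vectors of `{o}` and of its complement. -/
def localMatrix (α β γ δ ε : F) : Matrix Y Y F :=
  α • vecMulVec s s + β • vecMulVec s r + γ • vecMulVec r s + δ • vecMulVec r r + ε • diagonal r

theorem localMatrix_add (α β γ δ ε α' β' γ' δ' ε' : F) :
    localMatrix F o α β γ δ ε + localMatrix F o α' β' γ' δ' ε' =
      localMatrix F o (α + α') (β + β') (γ + γ') (δ + δ') (ε + ε') := by
  simp only [localMatrix]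
  module

theorem smul_localMatrix (c α β γ δ ε : F) :
    c • localMatrix F o α β γ δ ε = localMatrix F o (c * α) (c * β) (c * γ) (c * δ) (c * ε) := by
  simp only [localMatrix]
  module

theorem one_eq_localMatrix : (1 : Matrix Y Y F) = localMatrix F o 1 0 0 0 1 := by
  ext y z
  by_cases hy : y = o <;> by_cases hz : z = o <;>
    simp [localMatrix, vecMulVec_apply, coVec, hy, hz, one_apply, diagonal_apply, Ne.symm]

theorem diagonal_coVec_eq_localMatrix : diagonal r = localMatrix F o 0 0 0 0 1 := by
  simp [localMatrix]

/-- The adjacency matrix `J - I` of the relation `≠`. -/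
def offDiag (Y : Type*) [DecidableEq Y] : Matrix Y Y F := of fun y z => if y = z then 0 else 1

theorem offDiag_eq_localMatrix : offDiag F Y = localMatrix F o 0 1 1 1 (-1) := by
  ext y z
  by_cases hy : y = o <;> by_cases hz : z = o <;> by_cases hyz : y = z <;>
    simp_all [offDiag, localMatrix, vecMulVec_apply, coVec, eq_comm]

/-- The image in `F` of `k = |Y| - 1`, the valency of the relation `≠`. -/
noncomputable def complCard : F := (Nat.card {y // y ≠ o} : F)

local notation "k" => complCard F o

theorem one_sub_diagonal_coVec_eq_localMatrix :
    1 - diagonal r = localMatrix F o 1 0 0 0 0 := by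
  rw [one_eq_localMatrix F o]
  simp [localMatrix]

/-- For `k = |Y| - 1` invertible in `F`, the orthogonal idempotents `ssᵀ`, `k⁻¹ rrᵀ` and
`diag(r) - k⁻¹ rrᵀ`, the first two of which are diagonal matrix units of a full `2 × 2` matrix
algebra and the third of which spans the complementary ideal. -/
noncomputable def localIdempotent : Fin 3 → Matrix Y Y F :=
  ![localMatrix F o 1 0 0 0 0, localMatrix F o 0 0 0 k⁻¹ 0,
    localMatrix F o 0 0 0 (-k⁻¹) 1]

theorem sum_localIdempotent : ∑ c, localIdempotent F o c = 1 := by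
  simp [Fin.sum_univ_three, localIdempotent, localMatrix_add, one_eq_localMatrix F o]

variable [Fintype Y]

theorem single_dotProduct_coVec : s ⬝ᵥ r = 0 := by simp [coVec]

theorem coVec_dotProduct_single : r ⬝ᵥ s = 0 := by simp [coVec]

theorem single_dotProduct_single : s ⬝ᵥ s = 1 := by simp

theorem coVec_dotProduct_coVec : r ⬝ᵥ r = k := by
  rw [complCard, Nat.card_eq_fintype_card, Fintype.card_subtype, Finset.natCast_card_filter]
  exact Finset.sum_congr rfl fun y _ => by by_cases h : y = o <;> simp [coVec, h]

theorem diagonal_coVec_mulVec_single : diagonal r *ᵥ s = 0 := by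
  ext y
  by_cases h : y = o <;> simp [mulVec_diagonal, coVec, h]

theorem diagonal_coVec_mulVec_coVec : diagonal r *ᵥ r = r := by
  ext y
  by_cases h : y = o <;> simp [mulVec_diagonal, coVec, h]

theorem single_vecMul_diagonal_coVec : s ᵥ* diagonal r = 0 := by
  ext y
  by_cases h : y = o <;> simp [vecMul_diagonal, coVec, h]

theorem coVec_vecMul_diagonal_coVec : r ᵥ* diagonal r = r := by
  ext y
  by_cases h : y = o <;> simp [vecMul_diagonal, coVec, h]

theorem diagonal_coVec_mul_self : diagonal r * diagonal r = diagonal r := by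
  rw [diagonal_mul_diagonal]
  congr 1
  ext y
  by_cases h : y = o <;> simp [coVec, h]

theorem localMatrix_mul (α β γ δ ε α' β' γ' δ' ε' : F) :
    localMatrix F o α β γ δ ε * localMatrix F o α' β' γ' δ' ε' =
      localMatrix F o
        (α * α' + β * γ' * k)
        (α * β' + β * δ' * k + β * ε')
        (γ * α' + δ * γ' * k + ε * γ')
        (γ * β' + δ * δ' * k + δ * ε' + ε * δ')
        (ε * ε') := by
  simp only [localMatrix, mul_add, add_mul, smul_mul_assoc, mul_smul_comm,
    vecMulVec_mul_vecMulVec, vecMulVec_mul _ _ (diagonal r), mul_vecMulVec (diagonal r),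
    single_dotProduct_coVec, coVec_dotProduct_single, single_dotProduct_single,
    coVec_dotProduct_coVec,
    diagonal_coVec_mulVec_single, diagonal_coVec_mulVec_coVec, single_vecMul_diagonal_coVec,
    coVec_vecMul_diagonal_coVec, diagonal_coVec_mul_self, zero_smul, one_smul, vecMulVec_zero,
    zero_vecMulVec, smul_zero, vecMulVec_smul]
  module

/-- The span of `ssᵀ`, `srᵀ`, `rsᵀ`, `rrᵀ` and `diag(r)`, which for `|Y| ≥ 2` is the Terwilliger
algebra with respect to `o` of the one-class scheme on `Y`. -/
def localAlgebra : Subalgebra F (Matrix Y Y F) where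
  carrier := {b | ∃ α β γ δ ε, b = localMatrix F o α β γ δ ε}
  mul_mem' := by
    rintro _ _ ⟨α, β, γ, δ, ε, rfl⟩ ⟨α', β', γ', δ', ε', rfl⟩
    exact ⟨_, _, _, _, _, localMatrix_mul F o ..⟩
  add_mem' := by
    rintro _ _ ⟨α, β, γ, δ, ε, rfl⟩ ⟨α', β', γ', δ', ε', rfl⟩
    exact ⟨_, _, _, _, _, localMatrix_add F o ..⟩
  algebraMap_mem' c := by
    rw [Algebra.algebraMap_eq_smul_one, one_eq_localMatrix F o, smul_localMatrix]
    exact ⟨_, _, _, _, _, rfl⟩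

theorem localMatrix_mem (α β γ δ ε : F) : localMatrix F o α β γ δ ε ∈ localAlgebra F o :=
  ⟨_, _, _, _, _, rfl⟩

/-- `localAlgebra F o` is generated by `diag(r)` and `J - I`. -/
theorem localAlgebra_le {C : Subalgebra F (Matrix Y Y F)} (hD : diagonal r ∈ C)
    (hA : offDiag F Y ∈ C) : localAlgebra F o ≤ C := by
  have hQ := hD
  rw [diagonal_coVec_eq_localMatrix] at hQ
  have hP : localMatrix F o 1 0 0 0 0 ∈ C := by
    rw [← one_sub_diagonal_coVec_eq_localMatrix]
    exact sub_mem (one_mem C) hD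
  have hJ : localMatrix F o 1 1 1 1 0 ∈ C := by
    have := add_mem hA (one_mem C)
    rw [offDiag_eq_localMatrix F o, one_eq_localMatrix F o, localMatrix_add] at this
    simpa using this
  rintro _ ⟨α, β, γ, δ, ε, rfl⟩
  have h₂ : localMatrix F o 0 1 0 0 0 ∈ C := by
    simpa [localMatrix_mul] using mul_mem (mul_mem hP hJ) hQ
  have h₃ : localMatrix F o 0 0 1 0 0 ∈ C := by
    simpa [localMatrix_mul] using mul_mem (mul_mem hQ hJ) hP
  have h₄ : localMatrix F o 0 0 0 1 0 ∈ C := by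
    simpa [localMatrix_mul] using mul_mem (mul_mem hQ hJ) hQ
  have := add_mem (add_mem (add_mem (add_mem (C.smul_mem hP α) (C.smul_mem h₂ β))
    (C.smul_mem h₃ γ)) (C.smul_mem h₄ δ)) (C.smul_mem hQ ε)
  simpa [smul_localMatrix, localMatrix_add] using this

theorem localIdempotent_mem (c : Fin 3) : localIdempotent F o c ∈ localAlgebra F o := by
  fin_cases c <;> exact localMatrix_mem F o ..

/-- Every block between two of the idempotents is at most one-dimensional, spanned by an element
`m` that has an inner inverse `m'`. -/
theorem exists_span_block (hk : k ≠ 0) (c c' : Fin 3) :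
    ∃ m ∈ localAlgebra F o, ∃ m' ∈ localAlgebra F o, m * m' * m = m ∧
      ∀ b ∈ localAlgebra F o, ∃ t : F,
        localIdempotent F o c * b * localIdempotent F o c' = t • m := by
  have aux : ∀ α β γ δ ε α' β' γ' δ' ε' : F,
      localMatrix F o α β γ δ ε * localMatrix F o α' β' γ' δ' ε' *
        localMatrix F o α β γ δ ε = localMatrix F o α β γ δ ε →
      (∀ α₁ β₁ γ₁ δ₁ ε₁, ∃ t : F, localIdempotent F o c * localMatrix F o α₁ β₁ γ₁ δ₁ ε₁ *
        localIdempotent F o c' = t • localMatrix F o α β γ δ ε) →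
      ∃ m ∈ localAlgebra F o, ∃ m' ∈ localAlgebra F o, m * m' * m = m ∧
      ∀ b ∈ localAlgebra F o, ∃ t : F,
        localIdempotent F o c * b * localIdempotent F o c' = t • m := by
    intro α β γ δ ε α' β' γ' δ' ε' h₁ h₂
    refine ⟨_, localMatrix_mem F o .., _, localMatrix_mem F o .., h₁, ?_⟩
    rintro _ ⟨α₁, β₁, γ₁, δ₁, ε₁, rfl⟩
    exact h₂ α₁ β₁ γ₁ δ₁ ε₁
  fin_cases c <;> fin_cases c'
  -- The blocks `0` and `1` form a full `2 × 2` matrix algebra, block `2` is `F` times the third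
  -- idempotent, and the blocks between `{0, 1}` and `2` vanish.
  on_goal 9 => refine aux 0 0 0 (-k⁻¹) 1 0 0 0 (-k⁻¹) 1 ?_ fun α β γ δ ε => ⟨ε, ?_⟩
  on_goal 8 => refine aux 0 0 0 0 0 0 0 0 0 0 ?_ fun α β γ δ ε => ⟨0, ?_⟩
  on_goal 7 => refine aux 0 0 0 0 0 0 0 0 0 0 ?_ fun α β γ δ ε => ⟨0, ?_⟩
  on_goal 6 => refine aux 0 0 0 0 0 0 0 0 0 0 ?_ fun α β γ δ ε => ⟨0, ?_⟩
  on_goal 5 => refine aux 0 0 0 k⁻¹ 0 0 0 0 k⁻¹ 0 ?_ fun α β γ δ ε => ⟨δ * k + ε, ?_⟩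
  on_goal 4 => refine aux 0 0 1 0 0 0 k⁻¹ 0 0 0 ?_ fun α β γ δ ε => ⟨γ, ?_⟩
  on_goal 3 => refine aux 0 0 0 0 0 0 0 0 0 0 ?_ fun α β γ δ ε => ⟨0, ?_⟩
  on_goal 2 => refine aux 0 1 0 0 0 0 0 k⁻¹ 0 0 ?_ fun α β γ δ ε => ⟨β, ?_⟩
  on_goal 1 => refine aux 1 0 0 0 0 1 0 0 0 0 ?_ fun α β γ δ ε => ⟨α, ?_⟩
  all_goals
    simp only [localIdempotent, localMatrix_mul, smul_localMatrix, Fin.zero_eta, Fin.mk_one,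
      Fin.reduceFinMk, Matrix.cons_val]
    congr 1 <;> field_simp <;> ring

end LocalAlgebra

/-! ### Tensor products of matrices -/

section TensorMatrix

variable {ι : Type*} [Fintype ι] {Y : ι → Type*} {F : Type*} [Field F]

/-- The tensor product `⨂ h, b h` of square matrices, as a matrix indexed by `∏ h, Y h`. -/
def tensorMatrix (b : ∀ h, Matrix (Y h) (Y h) F) : Matrix (∀ h, Y h) (∀ h, Y h) F :=
  Matrix.of fun y z => ∏ h, b h (y h) (z h)

theorem tensorMatrix_one [∀ h, DecidableEq (Y h)] :
    tensorMatrix (1 : ∀ h, Matrix (Y h) (Y h) F) = 1 := by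
  ext y z
  simp [tensorMatrix, Matrix.one_apply, Finset.prod_ite_zero, funext_iff]

theorem tensorMatrix_smul (t : ι → F) (b : ∀ h, Matrix (Y h) (Y h) F) :
    tensorMatrix (fun h => t h • b h) = (∏ h, t h) • tensorMatrix b := by
  ext y z
  simp [tensorMatrix, Finset.prod_mul_distrib]

variable [DecidableEq ι]

theorem tensorMatrix_mul [∀ h, Fintype (Y h)] (b c : ∀ h, Matrix (Y h) (Y h) F) :
    tensorMatrix b * tensorMatrix c = tensorMatrix (b * c) := by
  ext y z
  simp only [tensorMatrix, Matrix.mul_apply, Matrix.of_apply, Pi.mul_apply,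
    Finset.prod_univ_sum, Fintype.piFinset_univ, Finset.prod_mul_distrib]

theorem tensorMatrix_update_add (b : ∀ h, Matrix (Y h) (Y h) F) (h : ι)
    (c c' : Matrix (Y h) (Y h) F) :
    tensorMatrix (Function.update b h (c + c')) =
      tensorMatrix (Function.update b h c) + tensorMatrix (Function.update b h c') := by
  ext y z
  simp only [tensorMatrix, Matrix.of_apply, Matrix.add_apply]
  rw [← Finset.mul_prod_erase _ _ (Finset.mem_univ h), ← Finset.mul_prod_erase _ _
    (Finset.mem_univ h), ← Finset.mul_prod_erase _ _ (Finset.mem_univ h)]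
  simp only [Function.update_self, Matrix.add_apply, add_mul]
  congr 2 <;> refine Finset.prod_congr rfl fun i hi => ?_ <;>
    simp [Function.update_of_ne (Finset.ne_of_mem_erase hi)]

theorem tensorMatrix_update_smul (b : ∀ h, Matrix (Y h) (Y h) F) (h : ι) (t : F)
    (c : Matrix (Y h) (Y h) F) :
    tensorMatrix (Function.update b h (t • c)) = t • tensorMatrix (Function.update b h c) := by
  ext y z
  simp only [tensorMatrix, Matrix.of_apply, Matrix.smul_apply, smul_eq_mul]
  rw [← Finset.mul_prod_erase _ _ (Finset.mem_univ h), ← Finset.mul_prod_erase _ _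
    (Finset.mem_univ h)]
  simp only [Function.update_self, Matrix.smul_apply, smul_eq_mul, mul_assoc]
  congr 2
  refine Finset.prod_congr rfl fun i hi => ?_
  simp [Function.update_of_ne (Finset.ne_of_mem_erase hi)]

theorem sum_tensorMatrix {κ : Type*} [Fintype κ] (e : ∀ h, κ → Matrix (Y h) (Y h) F) :
    ∑ c : ι → κ, tensorMatrix (fun h => e h (c h)) = tensorMatrix fun h => ∑ c, e h c := by
  ext y z
  simp only [tensorMatrix, Matrix.sum_apply, Matrix.of_apply, Finset.prod_univ_sum,
    Fintype.piFinset_univ]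

variable [∀ h, Fintype (Y h)] [∀ h, DecidableEq (Y h)]

/-- The preimage of a subalgebra `T` under the embedding
`b ↦ 1 ⊗ ⋯ ⊗ 1 ⊗ b ⊗ 1 ⊗ ⋯ ⊗ 1` at the coordinate `h`. -/
def factorSubalgebra (T : Subalgebra F (Matrix (∀ h, Y h) (∀ h, Y h) F)) (h : ι) :
    Subalgebra F (Matrix (Y h) (Y h) F) where
  carrier := {b | tensorMatrix (Function.update 1 h b) ∈ T}
  mul_mem' {b c} hb hc := by
    have : _ ∈ T := mul_mem (S := Subalgebra F _) hb hc
    rwa [tensorMatrix_mul, ← Function.update_mul, one_mul] at this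
  add_mem' {b c} hb hc := by
    have : _ ∈ T := add_mem (S := Subalgebra F _) hb hc
    rwa [← tensorMatrix_update_add] at this
  algebraMap_mem' t := by
    have h1 : Function.update (1 : ∀ h, Matrix (Y h) (Y h) F) h 1 = 1 :=
      Function.update_eq_self h _
    change tensorMatrix _ ∈ T
    rw [Algebra.algebraMap_eq_smul_one, tensorMatrix_update_smul, h1, tensorMatrix_one]
    exact T.smul_mem (one_mem T) t

theorem mem_factorSubalgebra {T : Subalgebra F (Matrix (∀ h, Y h) (∀ h, Y h) F)} {h : ι}
    {b : Matrix (Y h) (Y h) F} :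
    b ∈ factorSubalgebra T h ↔ tensorMatrix (Function.update 1 h b) ∈ T :=
  Iff.rfl

/-- `⨂ h, b h` is the product of the images of the `b h` under the coordinate embeddings. -/
theorem tensorMatrix_mem (T : Subalgebra F (Matrix (∀ h, Y h) (∀ h, Y h) F))
    (b : ∀ h, Matrix (Y h) (Y h) F) (hb : ∀ h, b h ∈ factorSubalgebra T h) :
    tensorMatrix b ∈ T := by
  have key : ∀ (s : Finset ι) (c : ∀ h, Matrix (Y h) (Y h) F),
      (∀ h ∈ s, c h ∈ factorSubalgebra T h) → (∀ h ∉ s, c h = 1) → tensorMatrix c ∈ T := by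
    intro s
    induction s using Finset.induction_on with
    | empty =>
      intro c _ hc
      rw [show c = 1 from funext fun h => hc h (Finset.notMem_empty h), tensorMatrix_one]
      exact one_mem T
    | insert a s ha ih =>
      intro c hc hc'
      have h1 : tensorMatrix (Function.update c a 1) ∈ T := by
        refine ih _ (fun h hh => ?_) fun h hh => ?_
        · rw [Function.update_of_ne (ne_of_mem_of_not_mem hh ha)]
          exact hc h (Finset.mem_insert_of_mem hh)
        · by_cases hha : h = a
          · subst hha; simp
          · rw [Function.update_of_ne hha]
            exact hc' h (by simp [hha, hh])
      have h2 : tensorMatrix (Function.update 1 a (c a)) ∈ T := hc a (Finset.mem_insert_self a s)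
      have := mul_mem h1 h2
      rwa [tensorMatrix_mul, ← Function.update_mul, mul_one, one_mul,
        Function.update_eq_self] at this
  exact key Finset.univ b (fun h _ => hb h) fun h hh => absurd (Finset.mem_univ h) hh

/-- The tensor product of a family of matrix algebras. -/
def tensorSubalgebra (B : ∀ h, Subalgebra F (Matrix (Y h) (Y h) F)) :
    Subalgebra F (Matrix (∀ h, Y h) (∀ h, Y h) F) :=
  Algebra.adjoin F {M | ∃ b, (∀ h, b h ∈ B h) ∧ M = tensorMatrix b}

theorem mem_span_of_mem_tensorSubalgebra {B : ∀ h, Subalgebra F (Matrix (Y h) (Y h) F)}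
    {M : Matrix (∀ h, Y h) (∀ h, Y h) F} (hM : M ∈ tensorSubalgebra B) :
    M ∈ Submodule.span F {M | ∃ b, (∀ h, b h ∈ B h) ∧ M = tensorMatrix b} := by
  let N : Submonoid (Matrix (∀ h, Y h) (∀ h, Y h) F) :=
    { carrier := {M | ∃ b, (∀ h, b h ∈ B h) ∧ M = tensorMatrix b}
      one_mem' := ⟨1, fun h => one_mem (B h), tensorMatrix_one.symm⟩
      mul_mem' := by
        rintro _ _ ⟨b, hb, rfl⟩ ⟨c, hc, rfl⟩
        exact ⟨b * c, fun h => mul_mem (hb h) (hc h), tensorMatrix_mul b c⟩ }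
  have h : M ∈ Subalgebra.toSubmodule (Algebra.adjoin F (N : Set _)) := hM
  rwa [Algebra.adjoin_eq_span, Submonoid.closure_eq] at h

/-- If every factor has a decomposition of `1` whose blocks are at most one-dimensional and spanned
by an element with an inner inverse, then the tensor product algebra is semiprime: its blocks have
the same property, and for a nonzero block `t • m` of `a` the element `ε' m' ε` witnesses
`a T a ≠ 0`, since `(t • m) m' (t • m) = t ^ 2 • m`. -/
theorem isSemiprimeRing_tensorSubalgebra {κ : Type*} [Fintype κ]
    {B : ∀ h, Subalgebra F (Matrix (Y h) (Y h) F)}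
    (e : ∀ h, κ → Matrix (Y h) (Y h) F) (he : ∀ h c, e h c ∈ B h) (he1 : ∀ h, ∑ c, e h c = 1)
    (hblock : ∀ h c c', ∃ m ∈ B h, ∃ m' ∈ B h, m * m' * m = m ∧
      ∀ b ∈ B h, ∃ t : F, e h c * b * e h c' = t • m) :
    IsSemiprimeRing (tensorSubalgebra B) := by
  have mem : ∀ b, (∀ h, b h ∈ B h) → tensorMatrix b ∈ tensorSubalgebra B :=
    fun b hb => Algebra.subset_adjoin ⟨b, hb, rfl⟩
  rintro ⟨a, ha⟩ hT
  have hT' : ∀ M ∈ tensorSubalgebra B, a * M * a = 0 :=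
    fun M hM => congrArg Subtype.val (hT ⟨M, hM⟩)
  let E : (ι → κ) → Matrix (∀ h, Y h) (∀ h, Y h) F := fun c => tensorMatrix fun h => e h (c h)
  have hE1 : ∑ c, E c = 1 := by
    rw [sum_tensorMatrix, ← tensorMatrix_one]
    exact congrArg tensorMatrix (funext he1)
  have hzero : ∀ c c', E c * a * E c' = 0 := by
    intro c c'
    choose m hm m' hm' hinner hspan using fun h => hblock h (c h) (c' h)
    have hline : ∀ M ∈ Submodule.span F {M | ∃ b, (∀ h, b h ∈ B h) ∧ M = tensorMatrix b},
        ∃ t : F, E c * M * E c' = t • tensorMatrix m := by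
      intro M hM
      induction hM using Submodule.span_induction with
      | mem M hM =>
        obtain ⟨b, hb, rfl⟩ := hM
        choose t ht using fun h => hspan h (b h) (hb h)
        refine ⟨∏ h, t h, ?_⟩
        rw [tensorMatrix_mul, tensorMatrix_mul, ← tensorMatrix_smul]
        exact congrArg tensorMatrix (funext ht)
      | zero => exact ⟨0, by simp⟩
      | add M M' _ _ h h' =>
        obtain ⟨t, ht⟩ := h
        obtain ⟨t', ht'⟩ := h'
        exact ⟨t + t', by rw [mul_add, add_mul, ht, ht', add_smul]⟩
      | smul u M _ h =>
        obtain ⟨t, ht⟩ := h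
        exact ⟨u * t, by rw [mul_smul_comm, smul_mul_assoc, ht, mul_smul]⟩
    obtain ⟨t, ht⟩ := hline a (mem_span_of_mem_tensorSubalgebra ha)
    have hm3 : tensorMatrix m * tensorMatrix m' * tensorMatrix m = tensorMatrix m := by
      rw [tensorMatrix_mul, tensorMatrix_mul]
      exact congrArg tensorMatrix (funext hinner)
    have h0 := hT' (E c' * tensorMatrix m' * E c)
      (mul_mem (mul_mem (mem _ fun h => he h _) (mem _ hm')) (mem _ fun h => he h _))
    have h1 : t • t • tensorMatrix m = 0 := by
      calc t • t • tensorMatrix m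
          = (t • tensorMatrix m) * tensorMatrix m' * (t • tensorMatrix m) := by
            rw [mul_smul_comm, smul_mul_assoc, smul_mul_assoc, hm3]
        _ = E c * (a * (E c' * tensorMatrix m' * E c) * a) * E c' := by
            rw [← ht]
            noncomm_ring
        _ = 0 := by rw [h0, mul_zero, zero_mul]
    rcases smul_eq_zero.1 h1 with h | h
    · rw [ht, h, zero_smul]
    · rw [ht, h]
  refine Subtype.ext ?_
  calc a = (∑ c, E c) * a * ∑ c, E c := by rw [hE1, one_mul, mul_one]
    _ = 0 := by
      rw [Finset.sum_mul, Finset.sum_mul_sum]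
      exact Finset.sum_eq_zero fun c _ => Finset.sum_eq_zero fun c' _ => hzero c c'

end TensorMatrix

/-! ### The Terwilliger algebra of a factorial scheme -/

section FactorialScheme

variable {n : ℕ} (U : Fin n → Type*) [∀ k, Fintype (U k)] [∀ k, DecidableEq (U k)]
  [∀ k, Nontrivial (U k)] (F : Type*) [Field F] (x : ∀ k, U k)

omit [∀ k, Fintype (U k)] in
theorem dualIdempotent_factorialScheme (g : Fin (2 ^ n - 1 + 1)) :
    (factorialScheme U).dualIdempotent F x g = tensorMatrix fun h : Fin n =>
      if (g : ℕ).testBit h then Matrix.diagonal (coVec F (x h))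
      else 1 - Matrix.diagonal (coVec F (x h)) := by
  classical
  have hentry : ∀ (y z : ∀ k, U k) (h : Fin n),
      (if (g : ℕ).testBit h then Matrix.diagonal (coVec F (x h))
        else 1 - Matrix.diagonal (coVec F (x h))) (y h) (z h) =
      if y h = z h ∧ (x h ≠ y h ↔ (g : ℕ).testBit h = true) then 1 else 0 := by
    intro y z h
    generalize y h = a, z h = b, x h = c
    by_cases hab : a = b
    · subst hab
      by_cases hca : c = a
      · subst hca; by_cases hb : (g : ℕ).testBit h = true <;> simp [hb, coVec]
      · by_cases hb : (g : ℕ).testBit h = true <;> simp [hb, coVec, hca, Ne.symm hca]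
    · by_cases hb : (g : ℕ).testBit h = true <;> simp [hb, hab]
  ext y z
  simp only [tensorMatrix, Matrix.of_apply, hentry, Finset.prod_ite_zero, Finset.prod_const_one]
  simp only [AssociationScheme.dualIdempotent, Matrix.diagonal_apply, factorialScheme,
    factorialRel, Finset.mem_univ, forall_const, forall_and, ← funext_iff, ite_and]
  congr

omit [∀ k, Fintype (U k)] in
theorem adjMatrix_factorialScheme (g : Fin (2 ^ n - 1 + 1)) :
    (factorialScheme U).adjMatrix F g = tensorMatrix fun h : Fin n =>
      if (g : ℕ).testBit h then offDiag F (U h) else 1 := by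
  classical
  have hentry : ∀ (y z : ∀ k, U k) (h : Fin n),
      (if (g : ℕ).testBit h then offDiag F (U h) else 1) (y h) (z h) =
      if (y h ≠ z h ↔ (g : ℕ).testBit h = true) then 1 else 0 := by
    intro y z h
    by_cases hb : (g : ℕ).testBit h <;> by_cases hyz : y h = z h <;>
      simp_all [offDiag, Matrix.one_apply]
  ext y z
  simp only [tensorMatrix, Matrix.of_apply, hentry, Finset.prod_ite_zero, Finset.prod_const_one]
  simp only [AssociationScheme.adjMatrix, Matrix.of_apply, factorialScheme, factorialRel,
    Finset.mem_univ, forall_const]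
  congr

/-- The index `g` of the relation "differ exactly at the coordinate `h`". -/
theorem exists_singletonIndex (h : Fin n) :
    ∃ g : Fin (2 ^ n - 1 + 1), ∀ k : Fin n, (g : ℕ).testBit k = true ↔ k = h := by
  obtain ⟨g, hg⟩ := exists_factorialIndex (· = h)
  exact ⟨g, fun k => (hg k).symm⟩

/-- In the coordinate `h`, the matrix `diag(r)` is the sum of those `E_g^*` whose index `g` has
digit `1` at `h`. -/
theorem diagonal_coVec_mem_factorSubalgebra (h : Fin n) :
    Matrix.diagonal (coVec F (x h)) ∈
      factorSubalgebra ((factorialScheme U).terwilliger F x) h := by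
  classical
  have hmem : ∑ g ∈ Finset.univ.filter fun g : Fin (2 ^ n - 1 + 1) => (g : ℕ).testBit h = true,
      (factorialScheme U).dualIdempotent F x g ∈ (factorialScheme U).terwilliger F x :=
    Subalgebra.sum_mem _ fun g _ => Algebra.subset_adjoin (Or.inl ⟨g, rfl⟩)
  rw [mem_factorSubalgebra]
  convert hmem using 1
  ext y z
  obtain ⟨i, hi, huniq⟩ := (factorialScheme U).existsUnique_rel x y
  have hih : x h ≠ y h ↔ (i : ℕ).testBit h = true := hi h
  have hentry : ∀ k : Fin n,
      Function.update (1 : ∀ k, Matrix (U k) (U k) F) h (Matrix.diagonal (coVec F (x h))) k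
        (y k) (z k) = if y k = z k ∧ (k = h → x k ≠ y k) then 1 else 0 := by
    intro k
    by_cases hk : k = h
    · subst hk
      simp [Matrix.diagonal_apply, coVec, ite_and, eq_comm (a := x k)]
    · simp [hk, Matrix.one_apply]
  have hL : tensorMatrix (Function.update 1 h (Matrix.diagonal (coVec F (x h)))) y z =
      if y = z ∧ x h ≠ y h then 1 else 0 := by
    simp only [tensorMatrix, Matrix.of_apply, hentry, Finset.prod_ite_zero,
      Finset.prod_const_one, Finset.mem_univ, forall_const, forall_and, ← funext_iff,
      forall_eq]
  rw [hL, Matrix.sum_apply]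
  simp only [AssociationScheme.dualIdempotent, Matrix.diagonal_apply]
  by_cases hyz : y = z
  · simp only [hyz, if_true]
    subst hyz
    by_cases hxy : x h = y h
    · rw [Finset.sum_eq_zero]
      · simp [hxy]
      · intro g hg
        refine if_neg fun hg' => ?_
        rw [huniq g hg', Finset.mem_filter] at hg
        exact hih.2 hg.2 hxy
    · rw [Finset.sum_eq_single_of_mem i (by simp [hih.1 hxy])]
      · rw [if_pos ⟨trivial, hxy⟩, if_pos hi]
      · intro g _ hg
        exact if_neg fun hg' => hg (huniq g hg')
  · simp [hyz]

theorem offDiag_mem_factorSubalgebra (h : Fin n) :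
    offDiag F (U h) ∈ factorSubalgebra ((factorialScheme U).terwilliger F x) h := by
  obtain ⟨g, hg⟩ := exists_singletonIndex h
  have hmem : (factorialScheme U).adjMatrix F g ∈ (factorialScheme U).terwilliger F x :=
    Algebra.subset_adjoin (Or.inr ⟨g, rfl⟩)
  rw [adjMatrix_factorialScheme] at hmem
  rw [mem_factorSubalgebra]
  convert hmem using 2
  ext1 k
  by_cases hk : k = h
  · subst hk; simp [(hg k).2 rfl]
  · simp [hk, mt (hg k).1 hk]

/-- The Terwilliger algebra of a factorial scheme is the tensor product of the Terwilliger algebras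
of the one-class schemes on its factors. -/
theorem terwilliger_factorialScheme :
    (factorialScheme U).terwilliger F x = tensorSubalgebra fun h => localAlgebra F (x h) := by
  refine le_antisymm (Algebra.adjoin_le ?_) (Algebra.adjoin_le ?_)
  · have hD : ∀ h, Matrix.diagonal (coVec F (x h)) ∈ localAlgebra F (x h) := fun h => by
      rw [diagonal_coVec_eq_localMatrix]
      exact localMatrix_mem F ..
    rintro _ (⟨g, rfl⟩ | ⟨g, rfl⟩)
    · rw [dualIdempotent_factorialScheme]
      refine Algebra.subset_adjoin ⟨_, fun h => ?_, rfl⟩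
      split_ifs
      · exact hD h
      · exact sub_mem (one_mem _) (hD h)
    · rw [adjMatrix_factorialScheme]
      refine Algebra.subset_adjoin ⟨_, fun h => ?_, rfl⟩
      split_ifs
      · rw [offDiag_eq_localMatrix F (x h)]
        exact localMatrix_mem F ..
      · exact one_mem _
  · rintro _ ⟨b, hb, rfl⟩
    exact tensorMatrix_mem _ b fun h => localAlgebra_le F (x h)
      (diagonal_coVec_mem_factorSubalgebra U F x h) (offDiag_mem_factorSubalgebra U F x h) (hb h)

omit [∀ k, Fintype (U k)] in
/-- The valency of the relation "differ exactly at the coordinate `h`" is `|U h| - 1`. -/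
theorem valency_eq_complCard (h : Fin n) {g : Fin (2 ^ n - 1 + 1)}
    (hg : ∀ k : Fin n, (g : ℕ).testBit k = true ↔ k = h) :
    ((factorialScheme U).valency g : F) = complCard F (x h) := by
  rw [complCard, (factorialScheme U).valency_eq_card g x]
  congr 1
  refine Nat.card_congr ⟨fun a => ⟨a.1 h, ((a.2 h).2 ((hg h).2 rfl)).symm⟩,
    fun u => ⟨Function.update x h u.1, fun k => ?_⟩, fun a => Subtype.ext ?_,
    fun u => Subtype.ext (by simp)⟩
  · rw [hg k]
    by_cases hk : k = h
    · subst hk; simpa using u.2.symm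
    · simp [hk]
  · refine funext fun k => ?_
    by_cases hk : k = h
    · subst hk; simp
    · refine (Function.update_of_ne hk _ _).trans ?_
      by_contra hne
      exact hk ((hg k).1 ((a.2 k).1 hne))

theorem isSemiprimeRing_terwilliger_factorialScheme
    (hk : ∀ g, ((factorialScheme U).valency g : F) ≠ 0) :
    IsSemiprimeRing ((factorialScheme U).terwilliger F x) := by
  rw [terwilliger_factorialScheme]
  refine isSemiprimeRing_tensorSubalgebra (fun h => localIdempotent F (x h))
    (fun h => localIdempotent_mem F (x h)) (fun h => sum_localIdempotent F (x h))
    fun h => exists_span_block F (x h) ?_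
  obtain ⟨g, hg⟩ := exists_singletonIndex h
  rw [← valency_eq_complCard U F x h hg]
  exact hk g

omit [∀ k, Fintype (U k)] [∀ k, DecidableEq (U k)] in
theorem exists_rel_factorialScheme (g : Fin (2 ^ n - 1 + 1)) :
    ∃ y, (factorialScheme U).rel g x y := by
  choose b hb using fun k => exists_ne (x k)
  refine ⟨fun k => if (g : ℕ).testBit k = true then b k else x k, fun k => ?_⟩
  by_cases h : (g : ℕ).testBit k = true <;> simp [h, (hb k).symm]

end FactorialScheme

theorem theorem6p17 (F : Type*) [Field F] (p : ℕ) [CharP F p]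
    (n : ℕ) (hn : 1 ≤ n) (U : Fin n → Type*)
    [∀ k, Fintype (U k)] [∀ k, DecidableEq (U k)] [∀ k, Nontrivial (U k)]
    (x : ∀ k, U k) :
    (IsSemisimpleRing ((factorialScheme U).terwilliger F x) ↔
      ∀ g, ¬ p ∣ (factorialScheme U).valency g) ∧
    (IsSemisimpleRing ((factorialScheme U).terwilliger F x) ↔
      ∀ g, IsSemisimpleRing ((factorialScheme U).TerwilligerCorner F x g)) := by
  simp only [← CharP.cast_eq_zero_iff F p]
  have : IsArtinianRing ((factorialScheme U).terwilliger F x) := IsArtinianRing.of_finite F _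
  have h₁ : IsSemisimpleRing ((factorialScheme U).terwilliger F x) →
      ∀ g, IsSemisimpleRing ((factorialScheme U).TerwilligerCorner F x g) := fun _ g =>
    have := isArtinianRing_corner
      ((factorialScheme U).isIdempotentElem_terwilligerIdempotent F x g)
    ((IsSemisimpleRing.isSemiprimeRing _).corner _).isSemisimpleRing
  have h₂ : (∀ g, IsSemisimpleRing ((factorialScheme U).TerwilligerCorner F x g)) →
      ∀ g, ((factorialScheme U).valency g : F) ≠ 0 := fun h g =>
    have := h g
    (factorialScheme U).valency_ne_zero_of_isSemiprimeRing_corner F x g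
      (exists_rel_factorialScheme U x g) (IsSemisimpleRing.isSemiprimeRing _)
  have h₃ : (∀ g, ((factorialScheme U).valency g : F) ≠ 0) →
      IsSemisimpleRing ((factorialScheme U).terwilliger F x) := fun h =>
    (isSemiprimeRing_terwilliger_factorialScheme U F x h).isSemisimpleRing
  exact ⟨⟨fun h => h₂ (h₁ h), h₃⟩, h₁, fun h => h₃ (h₂ h)⟩
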